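/- **Quantum query model.** For $n\in\mathbb N$ let $B_n=\{0,1\}^n$, and for $X=(x_1,\dots,x_n)\in B_n$ let $|X|=\sum_{i=1}^n x_i$. A quantum algorithm with $T$ queries starts in a unit vector $|\psi_0\rangle$ of a space $(\mathbb C^2)^{\otimes m}$ and computes $|\psi\rangle=U_TQ_XU_{T-1}Q_X\cdots U_1Q_XU_0|\psi_0\rangle$. Here $U_0,\dots,U_T$ are unitary, and neither they nor $|\psi_0\rangle$ depend on $X$; the query is $Q_X|i,b,z\rangle=|i,b\oplus x_i,z\rangle$, and it leaves $|i,b,z\rangle$ unchanged if $i$ is not the index of an input bit. A measurement of $|\psi\rangle$, not depending on $X$, then gives one of $M$ outcomes, outcome $j$ with probability $p_X(j)$, and on outcome $j$ the algorithm returns $\hat a(j)\in\mathbb R$ as an approximation of the mean $|X|/n$ (equivalently, $n\hat a(j)$ as an approximation of the count $|X|$). For $q\in[1,\infty)$ and a probability measure $\mu$ on $B_n$, its average expected counting error is $$e_1^{\mathrm{avg\text{-}exp}}(q,B_n,T)=n\sum_{X\in B_n}\mu(X)\Big(\sum_{j}\Big|\frac{|X|}{n}-\hat a(j)\Big|^q\,p_X(j)\Big)^{1/q}.$$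 **Corollary 5.1.** For every $n$ let $I=I_n\subseteq\{0,\dots,n\}$ be a set of consecutive integers with $|I_n|\to\infty$ as $n\to\infty$, such that $k(n-k)=\Theta(n^2)$ uniformly for $k\in I_n$; that is, $k(n-k)\ge\alpha n^2$ for a constant $\alpha>0$, all sufficiently large $n$ and all $k\in I_n$ (the upper bound always holds). Let $c>0$ be a constant, let $q\in[1,\infty)$ be fixed, and let $\Delta=\Delta_n>0$ with $\Delta_n=o(|I_n|)$. Then for all sufficiently large $n$, for every probability measure $\mu$ on $B_n$ with $$\mu(X)\ \ge\ \frac{c}{|I_n|}\,\frac1{\binom n{|X|}}\qquad\text{for every }X\in B_n\text{ with }|X|\in I_n,$$ and for every quantum algorithm on $B_n$ with $T$ queries, the condition $e_1^{\mathrm{avg\text{-}exp}}(q,B_n,T)\le\Delta_n$ implies $$T\ \ge\ C\,\min\Big(\frac n{\Delta_n},\,n\Big),\qquad\text{that is,}\qquad T=\Omega(\min(n/\Delta,n)),$$ where the constant $C>0$ depends only on $c$ and $\alpha$. -/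

import Mathlib

open Filter Asymptotics
open scoped Matrix ComplexOrder

noncomputable section

namespace BooleanMean

/-- The inputs `X ∈ {0,1}^n`. -/
abbrev Input (n : ℕ) : Type := Fin n → Bool

/-- The Hamming weight `|X|`, the number of ones of `X`. -/
def weight {n : ℕ} (X : Input n) : ℕ := (Finset.univ.filter fun i => X i = true).card

/-- The Boolean mean `a_X = |X| / n`. -/
def mean {n : ℕ} (X : Input n) : ℝ := (weight X : ℝ) / (n : ℝ)

/-- Labels `(i, b, z)` of the computational basis `|i, b, z⟩` of a register of `l + 1 + w` qubits:
`i` is the content of the `l` index qubits (read in binary), `b` that of the target qubit, and `z`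
that of the `w` work qubits. The state space is `(ℂ²)^{⊗ (l + 1 + w)}`, with coordinates in this
basis. -/
abbrev BasisState (l w : ℕ) : Type := Fin (2 ^ l) × Bool × Fin (2 ^ w)

/-- The action of a query on basis labels: `(i, b, z) ↦ (i, b ⊕ x_i, z)`, and indices `i` that do
not belong to an input bit leave the label unchanged. -/
def queryMap {n : ℕ} (l w : ℕ) (X : Input n) (s : BasisState l w) : BasisState l w :=
  (s.1, if h : (s.1 : ℕ) < n then xor s.2.1 (X ⟨s.1, h⟩) else s.2.1, s.2.2)

/-- The query operator `Q_X`, as the (permutation) matrix sending `|s⟩` to `|queryMap s⟩`. -/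
def queryOp {n : ℕ} (l w : ℕ) (X : Input n) : Matrix (BasisState l w) (BasisState l w) ℂ :=
  Matrix.of fun t s => if t = queryMap l w X s then 1 else 0

/-- A quantum algorithm with `T` queries on inputs of `n` bits: unitaries `U 0, …, U T` (the
values of `U` beyond `T` play no role) and an initial unit vector, all independent of the input;
a measurement with `M` outcomes, given by positive semidefinite `E j` with sum `1` (this includes
all projective measurements); and the number `est j` that is put out on outcome `j`. -/
structure QuantumAlgorithm (n T : ℕ) where
  /-- number of index qubits -/
  l : ℕ
  /-- number of work qubits -/
  w : ℕ
  /-- the index register can address every input bit -/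
  le_two_pow : n ≤ 2 ^ l
  U : ℕ → Matrix.unitaryGroup (BasisState l w) ℂ
  init : BasisState l w → ℂ
  init_unit : ∑ s, ‖init s‖ ^ 2 = 1
  M : ℕ
  E : Fin M → Matrix (BasisState l w) (BasisState l w) ℂ
  E_posSemidef : ∀ j, (E j).PosSemidef
  E_sum : ∑ j, E j = 1
  est : Fin M → ℝ

namespace QuantumAlgorithm

variable {n T : ℕ}

/-- The state `U_t Q_X U_{t-1} Q_X ⋯ U_1 Q_X U_0 |ψ₀⟩`. -/
def state (A : QuantumAlgorithm n T) (X : Input n) : ℕ → (BasisState A.l A.w → ℂ)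
  | 0 => (A.U 0).1 *ᵥ A.init
  | t + 1 => (A.U (t + 1)).1 *ᵥ (queryOp A.l A.w X *ᵥ state A X t)

/-- The probability `p_X(j) = ⟨ψ| E_j |ψ⟩` of outcome `j` on input `X`, where `ψ` is the state
after all `T` queries. -/
def prob (A : QuantumAlgorithm n T) (X : Input n) (j : Fin A.M) : ℝ :=
  (star (A.state X T) ⬝ᵥ (A.E j *ᵥ A.state X T)).re

/-- The expected error `(∑_j |a_X - â(j)|^q p_X(j))^{1/q}` on input `X`. -/
def expectedError (A : QuantumAlgorithm n T) (q : ℝ) (X : Input n) : ℝ :=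
  (∑ j, |mean X - A.est j| ^ q * A.prob X j) ^ (1 / q)

/-- The average expected error of the mean with respect to the weights `μ` on the inputs. -/
def avgExpectedError (A : QuantumAlgorithm n T) (q : ℝ) (μ : Input n → ℝ) : ℝ :=
  ∑ X, A.expectedError q X * μ X

/-- The average expected error of approximate counting: `n` times that of the mean. -/
def avgExpectedCountError (A : QuantumAlgorithm n T) (q : ℝ) (μ : Input n → ℝ) : ℝ :=
  (n : ℝ) * A.avgExpectedError q μ

end QuantumAlgorithm

end BooleanMean

end

/-! The proof is a hybrid argument averaged over pairs `X ⊂ Y` of sets of ones with `|X| = k` and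
`|Y| = k + L`. One query raises the squared distance of the two states by at most twice the weight
they put on `S = Y \ X` (`normSq_query_sub_le`). For a uniform pair, `S` is a uniform `L`-subset of
the zeros of `X` and also of the ones of `Y`. In the bulk both sets have at least `β = αn` elements,
so the mean squared distance after `T` queries is at most `4TL/β` (`totalDist_le`).

If `16TL ≤ β`, this is at most `1/4`, and the mean errors on levels `k` and `k + L` cannot both be
small compared with `L` (`le_levelError_add`). Summing over the interval `I` bounds the average
level error below by `L/12` (`interval_card_mul_le`). Since `μ` gives each level of `I` at least a
uniform share `c/|I|`, it follows that `cL ≤ 12Δ`, which fails for `L = ⌈13Δ/c⌉`. Such an `L` is of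
order `max(Δ, 1)`, so `16TL ≤ β` must fail, and this is the bound on `T`. -/

noncomputable section

namespace BooleanMean

/-! ### Averaging over subsets of fixed size -/

section Averaging

variable {ι : Type*} [DecidableEq ι]

/-- Each element lies in `(|A| - 1).choose (L - 1)` of the `L`-subsets; multiplying by `|A|` avoids
a division. -/
theorem card_mul_sum_powersetCard_sum (A : Finset ι) (L : ℕ) (p : ι → ℝ) :
    (A.card : ℝ) * ∑ S ∈ A.powersetCard L, ∑ i ∈ S, p i =
      L * (A.card.choose L : ℝ) * ∑ i ∈ A, p i := by
  have h1 : ∑ S ∈ A.powersetCard L, ∑ i ∈ S, p i =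
      ∑ i ∈ A, (((A.powersetCard L).filter fun S => {i} ⊆ S).card : ℝ) * p i := by
    have h2 : ∀ S ∈ A.powersetCard L, ∑ i ∈ S, p i = ∑ i ∈ A, if {i} ⊆ S then p i else 0 := by
      intro S hS
      rw [← Finset.sum_filter]
      refine Finset.sum_congr ?_ fun _ _ => rfl
      ext i
      have := (Finset.mem_powersetCard.1 hS).1
      simp only [Finset.mem_filter, Finset.singleton_subset_iff]
      exact ⟨fun h => ⟨this h, h⟩, fun h => h.2⟩
    rw [Finset.sum_congr rfl h2, Finset.sum_comm]
    refine Finset.sum_congr rfl fun i _ => ?_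
    rw [← Finset.sum_filter, Finset.sum_const, nsmul_eq_mul]
  rw [h1, Finset.mul_sum, Finset.mul_sum]
  refine Finset.sum_congr rfl fun i hi => ?_
  rcases L with _ | L
  · simp
  · rw [Finset.card_filter_powersetCard_subset _ _ _ (by simpa using hi) (by simp),
      ← mul_assoc]
    congr 1
    obtain ⟨a, ha⟩ : ∃ a, A.card = a + 1 :=
      Nat.exists_eq_add_of_lt (Finset.card_pos.2 ⟨i, hi⟩) |>.imp fun a h => by omega
    rw [ha]
    simp only [Finset.card_singleton, Nat.add_sub_cancel]
    have := Nat.add_one_mul_choose_eq a L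
    rw [mul_comm ((L + 1 : ℕ) : ℝ)]
    exact_mod_cast this

/-- Pairs of a `k`-set and a disjoint `L`-set, indexed by the `k`-set or by the union. -/
theorem sum_powersetCard_compl_union [Fintype ι] {M : Type*} [AddCommMonoid M] (k L : ℕ)
    (F : Finset ι → Finset ι → M) :
    ∑ X ∈ Finset.univ.powersetCard k, ∑ S ∈ (Xᶜ).powersetCard L, F X S =
      ∑ Y ∈ Finset.univ.powersetCard (k + L), ∑ S ∈ Y.powersetCard L, F (Y \ S) S := by
  rw [Finset.sum_sigma', Finset.sum_sigma']
  refine Finset.sum_bij' (fun x _ => ⟨x.1 ∪ x.2, x.2⟩) (fun y _ => ⟨y.1 \ y.2, y.2⟩) ?_ ?_ ?_ ?_ ?_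
  · rintro ⟨X, S⟩ h
    simp only [Finset.mem_sigma, Finset.mem_powersetCard, Finset.subset_univ, true_and,
      Finset.subset_compl_iff_disjoint_left] at h ⊢
    exact ⟨by rw [Finset.card_union_of_disjoint h.2.1, h.1, h.2.2], Finset.subset_union_right,
      h.2.2⟩
  · rintro ⟨Y, S⟩ h
    simp only [Finset.mem_sigma, Finset.mem_powersetCard, Finset.subset_univ, true_and,
      Finset.subset_compl_iff_disjoint_left] at h ⊢
    exact ⟨by rw [Finset.card_sdiff_of_subset h.2.1, h.1, h.2.2, Nat.add_sub_cancel],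
      Finset.sdiff_disjoint, h.2.2⟩
  · rintro ⟨X, S⟩ h
    simp only [Finset.mem_sigma, Finset.mem_powersetCard, Finset.subset_univ, true_and,
      Finset.subset_compl_iff_disjoint_left] at h
    simp [Finset.union_sdiff_cancel_right h.2.1]
  · rintro ⟨Y, S⟩ h
    simp only [Finset.mem_sigma, Finset.mem_powersetCard] at h
    simp [Finset.sdiff_union_of_subset h.2.1]
  · rintro ⟨X, S⟩ h
    simp only [Finset.mem_sigma, Finset.mem_powersetCard, Finset.subset_univ, true_and,
      Finset.subset_compl_iff_disjoint_left] at h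
    simp [Finset.union_sdiff_cancel_right h.2.1]

end Averaging

/-! ### Norms and measurement forms of state vectors -/

section StateVectors

variable {σ : Type*} [Fintype σ]

/-- The squared `ℓ²` norm of a coordinate vector. -/
def normSq (u : σ → ℂ) : ℝ := ∑ s, ‖u s‖ ^ 2

theorem star_dotProduct_self (u : σ → ℂ) : star u ⬝ᵥ u = (normSq u : ℂ) := by
  simp only [dotProduct, normSq, Pi.star_apply, Complex.ofReal_sum]
  refine Finset.sum_congr rfl fun s _ => ?_
  rw [Complex.star_def, Complex.conj_mul']
  simp

theorem normSq_unitary_mulVec [DecidableEq σ] (U : Matrix.unitaryGroup σ ℂ) (u : σ → ℂ) :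
    normSq (U.1 *ᵥ u) = normSq u := by
  have h : star (U.1 *ᵥ u) ⬝ᵥ (U.1 *ᵥ u) = star u ⬝ᵥ u := by
    rw [Matrix.star_mulVec, Matrix.dotProduct_mulVec, Matrix.vecMul_vecMul,
      ← Matrix.star_eq_conjTranspose, Matrix.UnitaryGroup.star_mul_self, Matrix.vecMul_one]
  rw [star_dotProduct_self, star_dotProduct_self] at h
  exact_mod_cast h

/-- The value `⟨u| E |u⟩` of the quadratic form of a matrix. -/
def quadForm (E : Matrix σ σ ℂ) (u : σ → ℂ) : ℝ := (star u ⬝ᵥ (E *ᵥ u)).re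

theorem quadForm_nonneg {E : Matrix σ σ ℂ} (hE : E.PosSemidef) (u : σ → ℂ) :
    0 ≤ quadForm E u :=
  (Complex.le_def.1 (hE.dotProduct_mulVec_nonneg u)).1

/-- Parallelogram law for the semi-inner product of `E`, applied to `v` and `u - v`. -/
theorem quadForm_le_two_mul_add {E : Matrix σ σ ℂ} (hE : E.PosSemidef) (u v : σ → ℂ) :
    quadForm E u ≤ 2 * quadForm E v + 2 * quadForm E (u - v) := by
  have h := quadForm_nonneg hE (u - v - v)
  have key : quadForm E u + quadForm E (u - v - v) =
      2 * quadForm E v + 2 * quadForm E (u - v) := by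
    simp only [quadForm, star_sub, Matrix.mulVec_sub, sub_dotProduct, dotProduct_sub,
      Complex.sub_re]
    ring
  linarith

theorem sum_quadForm [DecidableEq σ] {M : ℕ} {E : Fin M → Matrix σ σ ℂ} (hE : ∑ j, E j = 1)
    (u : σ → ℂ) : ∑ j, quadForm (E j) u = normSq u := by
  simp only [quadForm]
  rw [← Complex.re_sum, ← dotProduct_sum, ← Matrix.sum_mulVec, hE, Matrix.one_mulVec,
    star_dotProduct_self, Complex.ofReal_re]

end StateVectors

/-! ### Effect of one query -/

section Query

variable {n : ℕ} {l w : ℕ}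

theorem queryMap_involutive (X : Input n) : Function.Involutive (queryMap l w X) := by
  rintro ⟨i, b, z⟩
  by_cases h : (i : ℕ) < n <;> simp [queryMap, h]

theorem queryOp_mulVec (X : Input n) (u : BasisState l w → ℂ) (s : BasisState l w) :
    (queryOp l w X *ᵥ u) s = u (queryMap l w X s) := by
  have h : ∀ t, (s = queryMap l w X t) ↔ (t = queryMap l w X s) := fun t =>
    ⟨fun h => by rw [h, queryMap_involutive X t], fun h => by rw [h, queryMap_involutive X s]⟩
  simp [queryOp, Matrix.mulVec, dotProduct, h]

theorem normSq_queryOp_mulVec (X : Input n) (u : BasisState l w → ℂ) :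
    normSq (queryOp l w X *ᵥ u) = normSq u := by
  simp only [normSq, queryOp_mulVec]
  exact Equiv.sum_comp (queryMap_involutive (l := l) (w := w) X).toPerm fun s => ‖u s‖ ^ 2

/-- The weight that `u` puts on the basis states querying the input bit `i`. -/
def queryWeight (u : BasisState l w → ℂ) (i : Fin n) : ℝ :=
  ∑ s : BasisState l w, if (s.1 : ℕ) = i then ‖u s‖ ^ 2 else 0

theorem sum_queryWeight_eq (u : BasisState l w → ℂ) (S : Finset (Fin n)) :
    ∑ i ∈ S, queryWeight u i =
      ∑ s : BasisState l w, if ∃ i ∈ S, (s.1 : ℕ) = i then ‖u s‖ ^ 2 else 0 := by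
  simp only [queryWeight]
  rw [Finset.sum_comm]
  refine Finset.sum_congr rfl fun s _ => ?_
  split_ifs with h
  · obtain ⟨i, hi, his⟩ := h
    rw [Finset.sum_eq_single_of_mem i hi, if_pos his]
    intro j _ hj
    exact if_neg fun h => hj (Fin.ext (by omega))
  · push Not at h
    exact Finset.sum_eq_zero fun i hi => if_neg (h i hi)

theorem sum_queryWeight_le (u : BasisState l w → ℂ) (S : Finset (Fin n)) :
    ∑ i ∈ S, queryWeight u i ≤ normSq u := by
  rw [sum_queryWeight_eq]
  refine Finset.sum_le_sum fun s _ => ?_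
  split_ifs
  · exact le_rfl
  · positivity

/-- A query on two inputs that differ in the positions `S` moves two states apart by at most twice
the weight they put on `S`. -/
theorem normSq_query_sub_le (X Y : Input n) (S : Finset (Fin n)) (hS : ∀ i ∉ S, X i = Y i)
    (u v : BasisState l w → ℂ) :
    normSq (queryOp l w X *ᵥ u - queryOp l w Y *ᵥ v) ≤
      normSq (u - v) + 2 * (∑ i ∈ S, queryWeight u i + ∑ i ∈ S, queryWeight v i) := by
  let P : BasisState l w → Prop := fun s => ∃ i ∈ S, (s.1 : ℕ) = i
  have hsum : ∀ (Z : Input n) (u : BasisState l w → ℂ), ∑ i ∈ S, queryWeight u i =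
      ∑ s, if P s then ‖u (queryMap l w Z s)‖ ^ 2 else 0 := by
    intro Z u
    rw [sum_queryWeight_eq]
    exact (Equiv.sum_comp (queryMap_involutive (l := l) (w := w) Z).toPerm
      fun s => if P s then ‖u s‖ ^ 2 else 0).symm
  have hagree : ∀ s, ¬ P s → queryMap l w X s = queryMap l w Y s := by
    intro s hs
    simp only [queryMap]
    split_ifs with h
    · rw [hS ⟨s.1, h⟩ fun hm => hs ⟨_, hm, rfl⟩]
    · rfl
  have hnorm : normSq (u - v) = ∑ s, ‖u (queryMap l w X s) - v (queryMap l w X s)‖ ^ 2 :=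
    (Equiv.sum_comp (queryMap_involutive (l := l) (w := w) X).toPerm
      fun s => ‖u s - v s‖ ^ 2).symm
  rw [hnorm, hsum X u, hsum Y v, ← Finset.sum_add_distrib, Finset.mul_sum,
    ← Finset.sum_add_distrib]
  refine Finset.sum_le_sum fun s _ => ?_
  simp only [Pi.sub_apply, queryOp_mulVec]
  -- On `S` the estimate `‖a - b‖² ≤ 2‖a‖² + 2‖b‖²` suffices; off `S` both queries permute the basis
  -- in the same way.
  by_cases hs : P s
  · simp only [hs, if_true]
    have h1 := norm_sub_le (u (queryMap l w X s)) (v (queryMap l w Y s))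
    have h2 : ‖u (queryMap l w X s) - v (queryMap l w Y s)‖ ^ 2 ≤
        (‖u (queryMap l w X s)‖ + ‖v (queryMap l w Y s)‖) ^ 2 := by gcongr
    nlinarith [sq_nonneg (‖u (queryMap l w X s)‖ - ‖v (queryMap l w Y s)‖),
      sq_nonneg ‖u (queryMap l w X s) - v (queryMap l w X s)‖]
  · simp [hs, hagree s hs]

end Query

/-- Both sides count pairs of a `k`-set and a disjoint `L`-set. -/
theorem choose_mul_choose_eq (n k L : ℕ) :
    (n.choose (k + L) : ℝ) * ((k + L).choose L : ℝ) = n.choose k * (n - k).choose L := by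
  have h := Nat.choose_mul (n := n) (k := k + L) (s := k) (Nat.le_add_right k L)
  rw [Nat.choose_symm_add, Nat.add_sub_cancel_left] at h
  exact_mod_cast h

/-- The input whose ones are the elements of `S`. -/
def indicatorInput {n : ℕ} (S : Finset (Fin n)) : Input n := fun i => decide (i ∈ S)

theorem weight_indicatorInput {n : ℕ} (S : Finset (Fin n)) :
    weight (indicatorInput S) = S.card := by
  simp [weight, indicatorInput]

/-- Inputs correspond to the sets of positions of their ones. -/
def indicatorEquiv (n : ℕ) : Finset (Fin n) ≃ Input n where
  toFun := indicatorInput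
  invFun X := Finset.univ.filter fun i => X i = true
  left_inv S := by ext i; simp [indicatorInput]
  right_inv X := by ext i; simp [indicatorInput]

/-- A pointwise tradeoff between the errors of an estimate `e` at two points at distance `L`. -/
theorem mul_le_abs_sub_add {p r d x y e L : ℝ} (hL : 0 ≤ L) (hxy : y = x + L) (hp : 0 ≤ p)
    (hr : 0 ≤ r) (hd : 0 ≤ d) (h : p ≤ 2 * r + 2 * d) :
    p * L ≤ |x - e| * p + 2 * (|y - e| * r) + 2 * L * d := by
  -- The split caps the error that multiplies `d` at `L`; estimates far from both points would
  -- otherwise make that term unbounded.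
  rcases le_total L |y - e| with hy | hy
  · nlinarith [mul_le_mul_of_nonneg_right h hL, mul_nonneg (abs_nonneg (x - e)) hp,
      mul_le_mul_of_nonneg_right hy hr]
  · have h1 : L ≤ |x - e| + |y - e| := by
      have := abs_sub_le y e x
      rw [abs_sub_comm e x] at this
      have h2 := le_abs_self (y - x)
      linarith
    nlinarith [mul_le_mul_of_nonneg_left h1 hp, mul_le_mul_of_nonneg_right h (abs_nonneg (y - e)),
      mul_le_mul_of_nonneg_right hy hd]

/-! ### Error and state distance of an algorithm -/

namespace QuantumAlgorithm

variable {n T : ℕ} (A : QuantumAlgorithm n T)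

theorem normSq_state (X : Input n) (t : ℕ) : normSq (A.state X t) = 1 := by
  induction t with
  | zero => rw [state, normSq_unitary_mulVec]; exact A.init_unit
  | succ t ih => rw [state, normSq_unitary_mulVec, normSq_queryOp_mulVec, ih]

theorem prob_nonneg (X : Input n) (j : Fin A.M) : 0 ≤ A.prob X j :=
  quadForm_nonneg (A.E_posSemidef j) _

theorem sum_prob (X : Input n) : ∑ j, A.prob X j = 1 :=
  (sum_quadForm A.E_sum _).trans (A.normSq_state X T)

/-- The expected absolute error of the count on input `X`. -/
def countError (X : Input n) : ℝ := ∑ j, |(weight X : ℝ) - n * A.est j| * A.prob X j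

theorem countError_nonneg (X : Input n) : 0 ≤ A.countError X :=
  Finset.sum_nonneg fun j _ => mul_nonneg (abs_nonneg _) (A.prob_nonneg X j)

/-- Monotonicity of power means reduces every `q` to `q = 1`, so the final constant does not depend
on `q`. -/
theorem countError_le (hn : 0 < n) {q : ℝ} (hq : 1 ≤ q) (X : Input n) :
    A.countError X ≤ n * A.expectedError q X := by
  have hn' : (0 : ℝ) < n := by exact_mod_cast hn
  have h := Real.arith_mean_le_rpow_mean Finset.univ (fun j => A.prob X j)
    (fun j => |mean X - A.est j|) (fun j _ => A.prob_nonneg X j) (A.sum_prob X)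
    (fun j _ => abs_nonneg _) hq
  have he : A.countError X = n * ∑ j, A.prob X j * |mean X - A.est j| := by
    rw [countError, Finset.mul_sum]
    refine Finset.sum_congr rfl fun j _ => ?_
    have : (weight X : ℝ) - n * A.est j = n * (mean X - A.est j) := by
      rw [mean]; field_simp
    rw [this, abs_mul, abs_of_pos hn']
    ring
  rw [he, expectedError]
  refine mul_le_mul_of_nonneg_left (h.trans_eq ?_) hn'.le
  simp only [mul_comm]

/-- The squared distance of the states on two inputs after `t` queries. -/
def stateDist (t : ℕ) (X Y : Input n) : ℝ := normSq (A.state X t - A.state Y t)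

theorem stateDist_zero (X Y : Input n) : A.stateDist 0 X Y = 0 := by
  simp [stateDist, state, normSq]

theorem stateDist_succ_le (t : ℕ) (X Y : Input n) (S : Finset (Fin n))
    (hS : ∀ i ∉ S, X i = Y i) :
    A.stateDist (t + 1) X Y ≤ A.stateDist t X Y +
      2 * (∑ i ∈ S, queryWeight (A.state X t) i + ∑ i ∈ S, queryWeight (A.state Y t) i) := by
  have h := normSq_query_sub_le X Y S hS (A.state X t) (A.state Y t)
  rw [stateDist, state, state, ← Matrix.mulVec_sub, normSq_unitary_mulVec]
  exact h

theorem le_countError_add (X Y : Input n) {L : ℕ} (hXY : weight Y = weight X + L) :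
    (L : ℝ) ≤ A.countError X + 2 * A.countError Y + 2 * L * A.stateDist T X Y := by
  have h := Finset.sum_le_sum fun j (_ : j ∈ Finset.univ) =>
    mul_le_abs_sub_add (e := n * A.est j) (Nat.cast_nonneg L)
      (show (weight Y : ℝ) = weight X + L by exact_mod_cast hXY)
      (A.prob_nonneg X j) (A.prob_nonneg Y j)
      (quadForm_nonneg (A.E_posSemidef j) (A.state X T - A.state Y T))
      (quadForm_le_two_mul_add (A.E_posSemidef j) (A.state X T) (A.state Y T))
  rw [← Finset.sum_mul, A.sum_prob, one_mul, Finset.sum_add_distrib, Finset.sum_add_distrib,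
    ← Finset.mul_sum, ← Finset.mul_sum, sum_quadForm A.E_sum] at h
  exact h

/-- The sum of the squared distances over all pairs of a `k`-set and a `(k + L)`-set above it. -/
def totalDist (k L t : ℕ) : ℝ :=
  ∑ X ∈ (Finset.univ : Finset (Fin n)).powersetCard k, ∑ S ∈ (Xᶜ).powersetCard L,
    A.stateDist t (indicatorInput X) (indicatorInput (X ∪ S))

theorem sum_powersetCard_queryWeight_le (X : Input n) (t : ℕ) (B : Finset (Fin n)) (L : ℕ) {β : ℝ}
    (hβ : 0 < β) (hB : β ≤ B.card) :
    ∑ S ∈ B.powersetCard L, ∑ i ∈ S, queryWeight (A.state X t) i ≤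
      (B.card.choose L : ℝ) * (L / β) := by
  have h := card_mul_sum_powersetCard_sum B L (queryWeight (A.state X t))
  have h1 := sum_queryWeight_le (A.state X t) B
  rw [A.normSq_state] at h1
  have h0 : 0 ≤ ∑ S ∈ B.powersetCard L, ∑ i ∈ S, queryWeight (A.state X t) i :=
    Finset.sum_nonneg fun S _ => Finset.sum_nonneg fun i _ => Finset.sum_nonneg fun s _ => by
      split_ifs
      · positivity
      · exact le_rfl
  rw [← mul_div_assoc, le_div_iff₀ hβ]
  calc _ ≤ (∑ S ∈ B.powersetCard L, ∑ i ∈ S, queryWeight (A.state X t) i) * B.card := by gcongr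
    _ = L * (B.card.choose L : ℝ) * ∑ i ∈ B, queryWeight (A.state X t) i := by rw [mul_comm, h]
    _ ≤ L * (B.card.choose L : ℝ) * 1 := by gcongr
    _ = _ := by ring

theorem totalDist_succ_le {k L : ℕ} (t : ℕ) {β : ℝ} (hβ : 0 < β) (hk : β ≤ k)
    (hnk : β ≤ ((n - k : ℕ) : ℝ)) :
    A.totalDist k L (t + 1) ≤ A.totalDist k L t +
      4 * (L / β) * ((n.choose k : ℝ) * (n - k).choose L) := by
  have h1 : ∑ X ∈ (Finset.univ : Finset (Fin n)).powersetCard k, ∑ S ∈ (Xᶜ).powersetCard L,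
      ∑ i ∈ S, queryWeight (A.state (indicatorInput X) t) i ≤
        (n.choose k : ℝ) * (n - k).choose L * (L / β) := by
    calc _ ≤ ∑ X ∈ (Finset.univ : Finset (Fin n)).powersetCard k,
            ((n - k).choose L : ℝ) * (L / β) := by
          refine Finset.sum_le_sum fun X hX => ?_
          have hc : (Xᶜ).card = n - k := by
            rw [Finset.card_compl, Fintype.card_fin, (Finset.mem_powersetCard.1 hX).2]
          have := A.sum_powersetCard_queryWeight_le (indicatorInput X) t Xᶜ L hβ (by rwa [hc])
          rwa [hc] at this
      _ = _ := by
          rw [Finset.sum_const, Finset.card_powersetCard, Finset.card_univ, Fintype.card_fin,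
            nsmul_eq_mul, mul_assoc]
  have h2 : ∑ X ∈ (Finset.univ : Finset (Fin n)).powersetCard k, ∑ S ∈ (Xᶜ).powersetCard L,
      ∑ i ∈ S, queryWeight (A.state (indicatorInput (X ∪ S)) t) i ≤
        (n.choose k : ℝ) * (n - k).choose L * (L / β) := by
    -- The state now depends on the union alone, so for fixed `Y` the averaging runs over the
    -- `L`-subsets of its ones.
    rw [sum_powersetCard_compl_union k L fun X S =>
      ∑ i ∈ S, queryWeight (A.state (indicatorInput (X ∪ S)) t) i]
    calc _ ≤ ∑ Y ∈ (Finset.univ : Finset (Fin n)).powersetCard (k + L),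
            ((k + L).choose L : ℝ) * (L / β) := by
          refine Finset.sum_le_sum fun Y hY => ?_
          have hc : Y.card = k + L := (Finset.mem_powersetCard.1 hY).2
          have := A.sum_powersetCard_queryWeight_le (indicatorInput Y) t Y L hβ
            (by rw [hc]; push_cast; linarith [(Nat.cast_nonneg L : (0 : ℝ) ≤ L)])
          rw [hc] at this
          refine le_trans (le_of_eq ?_) this
          refine Finset.sum_congr rfl fun S hS => ?_
          rw [Finset.sdiff_union_of_subset (Finset.mem_powersetCard.1 hS).1]
      _ = _ := by
          rw [Finset.sum_const, Finset.card_powersetCard, Finset.card_univ, Fintype.card_fin,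
            nsmul_eq_mul, ← mul_assoc, choose_mul_choose_eq]
  have h3 : A.totalDist k L (t + 1) ≤
      ∑ X ∈ (Finset.univ : Finset (Fin n)).powersetCard k, ∑ S ∈ (Xᶜ).powersetCard L,
        (A.stateDist t (indicatorInput X) (indicatorInput (X ∪ S)) +
          2 * (∑ i ∈ S, queryWeight (A.state (indicatorInput X) t) i +
            ∑ i ∈ S, queryWeight (A.state (indicatorInput (X ∪ S)) t) i)) := by
    refine Finset.sum_le_sum fun X _ => Finset.sum_le_sum fun S _ => ?_
    refine A.stateDist_succ_le t _ _ S fun i hi => ?_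
    simp [indicatorInput, hi]
  simp only [Finset.sum_add_distrib, ← Finset.mul_sum] at h3
  rw [← totalDist] at h3
  linarith

theorem totalDist_le {k L : ℕ} (t : ℕ) {β : ℝ} (hβ : 0 < β) (hk : β ≤ k)
    (hnk : β ≤ ((n - k : ℕ) : ℝ)) :
    A.totalDist k L t ≤ 4 * t * (L / β) * ((n.choose k : ℝ) * (n - k).choose L) := by
  induction t with
  | zero => simp [totalDist, stateDist_zero]
  | succ t ih =>
    have := A.totalDist_succ_le (L := L) t hβ hk hnk
    push_cast
    linarith

/-! ### Errors averaged over Hamming levels -/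

/-- The average of the expected count error over the inputs of weight `k`. -/
def levelError (k : ℕ) : ℝ :=
  (∑ X ∈ (Finset.univ : Finset (Fin n)).powersetCard k, A.countError (indicatorInput X)) /
    n.choose k

theorem levelError_nonneg (k : ℕ) : 0 ≤ A.levelError k :=
  div_nonneg (Finset.sum_nonneg fun _ _ => A.countError_nonneg _) (Nat.cast_nonneg _)

theorem le_levelError_add {k L : ℕ} (hkL : k + L ≤ n) {β : ℝ} (hβ : 0 < β) (hk : β ≤ k)
    (hnk : β ≤ ((n - k : ℕ) : ℝ)) :
    (L : ℝ) ≤ A.levelError k + 2 * A.levelError (k + L) + 2 * L * (4 * T * (L / β)) := by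
  set N : ℝ := (n.choose k : ℝ) * (n - k).choose L with hN
  have c1 : (0 : ℝ) < n.choose k := by exact_mod_cast Nat.choose_pos (by omega)
  have c2 : (0 : ℝ) < (n - k).choose L := by exact_mod_cast Nat.choose_pos (by omega)
  have c3 : (0 : ℝ) < n.choose (k + L) := by exact_mod_cast Nat.choose_pos hkL
  have hNpos : 0 < N := mul_pos c1 c2
  have hcompl : ∀ X ∈ (Finset.univ : Finset (Fin n)).powersetCard k, (Xᶜ).card = n - k := by
    intro X hX
    rw [Finset.card_compl, Fintype.card_fin, (Finset.mem_powersetCard.1 hX).2]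
  have hconst : ∑ X ∈ (Finset.univ : Finset (Fin n)).powersetCard k,
      ∑ S ∈ (Xᶜ).powersetCard L, (L : ℝ) = N * L := by
    have : ∀ X ∈ (Finset.univ : Finset (Fin n)).powersetCard k,
        ∑ S ∈ (Xᶜ).powersetCard L, (L : ℝ) = (n - k).choose L * L := by
      intro X hX
      rw [Finset.sum_const, Finset.card_powersetCard, hcompl X hX, nsmul_eq_mul]
    rw [Finset.sum_congr rfl this, Finset.sum_const, Finset.card_powersetCard, Finset.card_univ,
      Fintype.card_fin, nsmul_eq_mul, ← mul_assoc]
  have hX : ∑ X ∈ (Finset.univ : Finset (Fin n)).powersetCard k,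
      ∑ S ∈ (Xᶜ).powersetCard L, A.countError (indicatorInput X) = N * A.levelError k := by
    have : ∀ X ∈ (Finset.univ : Finset (Fin n)).powersetCard k,
        ∑ S ∈ (Xᶜ).powersetCard L, A.countError (indicatorInput X) =
          (n - k).choose L * A.countError (indicatorInput X) := by
      intro X hX
      rw [Finset.sum_const, Finset.card_powersetCard, hcompl X hX, nsmul_eq_mul]
    rw [Finset.sum_congr rfl this, ← Finset.mul_sum, levelError, hN]
    field_simp
  have hY : ∑ X ∈ (Finset.univ : Finset (Fin n)).powersetCard k,
      ∑ S ∈ (Xᶜ).powersetCard L, A.countError (indicatorInput (X ∪ S)) =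
        N * A.levelError (k + L) := by
    rw [sum_powersetCard_compl_union k L fun X S => A.countError (indicatorInput (X ∪ S))]
    have : ∀ Y ∈ (Finset.univ : Finset (Fin n)).powersetCard (k + L),
        ∑ S ∈ Y.powersetCard L, A.countError (indicatorInput (Y \ S ∪ S)) =
          (k + L).choose L * A.countError (indicatorInput Y) := by
      intro Y hY
      rw [Finset.sum_congr rfl fun S hS => by
        rw [Finset.sdiff_union_of_subset (Finset.mem_powersetCard.1 hS).1],
        Finset.sum_const, Finset.card_powersetCard, (Finset.mem_powersetCard.1 hY).2, nsmul_eq_mul]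
    rw [Finset.sum_congr rfl this, ← Finset.mul_sum, levelError, hN, ← choose_mul_choose_eq]
    field_simp
  have hsum : ∑ X ∈ (Finset.univ : Finset (Fin n)).powersetCard k,
      ∑ S ∈ (Xᶜ).powersetCard L, (L : ℝ) ≤
      ∑ X ∈ (Finset.univ : Finset (Fin n)).powersetCard k, ∑ S ∈ (Xᶜ).powersetCard L,
        (A.countError (indicatorInput X) + 2 * A.countError (indicatorInput (X ∪ S)) +
          2 * L * A.stateDist T (indicatorInput X) (indicatorInput (X ∪ S))) := by
    refine Finset.sum_le_sum fun X _ => Finset.sum_le_sum fun S hS => ?_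
    refine A.le_countError_add _ _ ?_
    obtain ⟨h1, h2⟩ := Finset.mem_powersetCard.1 hS
    rw [weight_indicatorInput, weight_indicatorInput,
      Finset.card_union_of_disjoint (Finset.subset_compl_iff_disjoint_left.1 h1), h2]
  simp only [Finset.sum_add_distrib, ← Finset.mul_sum] at hsum
  rw [hconst, hX, hY, ← totalDist] at hsum
  have hD := mul_le_mul_of_nonneg_left (A.totalDist_le (L := L) T hβ hk hnk)
    (by positivity : (0 : ℝ) ≤ 2 * L)
  refine le_of_mul_le_mul_left ?_ hNpos
  rw [← hN] at hD
  linarith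

/-- The average error bounds the errors on the levels that the distribution charges. -/
theorem sum_levelError_le (hn : 0 < n) {q : ℝ} (hq : 1 ≤ q) {μ : Input n → ℝ}
    (hμ : ∀ X, 0 ≤ μ X) {I : Finset ℕ} {κ : ℝ}
    (h : ∀ X : Input n, weight X ∈ I → κ * (1 / (n.choose (weight X) : ℝ)) ≤ μ X) :
    κ * ∑ k ∈ I, A.levelError k ≤ A.avgExpectedCountError q μ := by
  have hn' : (0 : ℝ) < n := by exact_mod_cast hn
  have hnn : ∀ X, 0 ≤ μ X * A.countError X := fun X => mul_nonneg (hμ X) (A.countError_nonneg X)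
  calc κ * ∑ k ∈ I, A.levelError k
      = ∑ k ∈ I, ∑ S ∈ (Finset.univ : Finset (Fin n)).powersetCard k,
          κ * (1 / (n.choose k : ℝ)) * A.countError (indicatorInput S) := by
        rw [Finset.mul_sum]
        refine Finset.sum_congr rfl fun k _ => ?_
        rw [levelError, ← Finset.mul_sum]
        ring
    _ ≤ ∑ k ∈ I, ∑ S ∈ (Finset.univ : Finset (Fin n)).powersetCard k,
          μ (indicatorInput S) * A.countError (indicatorInput S) := by
        refine Finset.sum_le_sum fun k hk => Finset.sum_le_sum fun S hS => ?_
        refine mul_le_mul_of_nonneg_right ?_ (A.countError_nonneg _)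
        have hw : weight (indicatorInput S) = k := by
          rw [weight_indicatorInput, (Finset.mem_powersetCard.1 hS).2]
        have := h (indicatorInput S) (by rwa [hw])
        rwa [hw] at this
    _ = ∑ S ∈ (Finset.univ : Finset (Finset (Fin n))).filter fun S => S.card ∈ I,
          μ (indicatorInput S) * A.countError (indicatorInput S) := by
        rw [← Finset.sum_fiberwise_of_maps_to (g := Finset.card) (t := I)
          fun S hS => (Finset.mem_filter.1 hS).2]
        refine Finset.sum_congr rfl fun k hk => Finset.sum_congr ?_ fun _ _ => rfl
        ext S
        simp only [Finset.mem_powersetCard_univ, Finset.mem_filter, Finset.mem_univ, true_and]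
        exact ⟨fun h => ⟨by rwa [h], h⟩, fun h => h.2⟩
    _ ≤ ∑ S : Finset (Fin n), μ (indicatorInput S) * A.countError (indicatorInput S) :=
        Finset.sum_le_sum_of_subset_of_nonneg (Finset.filter_subset _ _) fun S _ _ => hnn _
    _ = ∑ X : Input n, μ X * A.countError X :=
        Equiv.sum_comp (indicatorEquiv n) fun X => μ X * A.countError X
    _ ≤ ∑ X : Input n, μ X * (n * A.expectedError q X) :=
        Finset.sum_le_sum fun X _ =>
          mul_le_mul_of_nonneg_left (A.countError_le hn hq X) (hμ X)
    _ = A.avgExpectedCountError q μ := by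
        rw [avgExpectedCountError, avgExpectedError, Finset.mul_sum]
        exact Finset.sum_congr rfl fun X _ => by ring

/-- Summing the tradeoff between levels at distance `L` over an interval of levels. -/
theorem interval_card_mul_le {a b L : ℕ} (hb : ∀ k ∈ Finset.Icc a b, k ≤ n) {β : ℝ} (hβ : 0 < β)
    (hk : ∀ k ∈ Finset.Icc a b, β ≤ k ∧ β ≤ ((n - k : ℕ) : ℝ))
    (hL : 2 * L ≤ (Finset.Icc a b).card) (hT : 16 * (T * L) ≤ β) :
    ((Finset.Icc a b).card : ℝ) * L ≤ 12 * ∑ k ∈ Finset.Icc a b, A.levelError k := by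
  have hLb : ∀ k ∈ Finset.Icc a b, k + L ∈ Finset.Icc a b →
      (L : ℝ) / 2 ≤ A.levelError k + 2 * A.levelError (k + L) := by
    intro k h1 h2
    have h := A.le_levelError_add (hb _ h2) hβ (hk k h1).1 (hk k h1).2
    have h3 : 4 * (T : ℝ) * (L / β) ≤ 1 / 4 := by
      rw [← mul_div_assoc, div_le_iff₀ hβ]; linarith
    have h4 := mul_le_mul_of_nonneg_left h3 (by positivity : (0 : ℝ) ≤ 2 * L)
    linarith
  set J := (Finset.Icc a b).filter fun k => k + L ∈ Finset.Icc a b with hJ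
  have hJcard : ((Finset.Icc a b).card : ℝ) ≤ 2 * J.card := by
    have hsub : Finset.Ico a (b + 1 - L) ⊆ J := by
      intro k
      simp only [hJ, Finset.mem_filter, Finset.mem_Icc, Finset.mem_Ico]
      omega
    have h1 := Finset.card_le_card hsub
    rw [Nat.card_Ico] at h1
    rw [Nat.card_Icc] at hL ⊢
    have : b + 1 - a ≤ 2 * J.card := by omega
    exact_mod_cast this
  have h1 : ∑ k ∈ J, A.levelError k ≤ ∑ k ∈ Finset.Icc a b, A.levelError k :=
    Finset.sum_le_sum_of_subset_of_nonneg (Finset.filter_subset _ _)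
      fun k _ _ => A.levelError_nonneg k
  have h2 : ∑ k ∈ J, A.levelError (k + L) ≤ ∑ k ∈ Finset.Icc a b, A.levelError k := by
    rw [← Finset.sum_image (f := A.levelError) (g := fun k => k + L)
      fun x _ y _ h => Nat.add_right_cancel h]
    refine Finset.sum_le_sum_of_subset_of_nonneg ?_ fun k _ _ => A.levelError_nonneg k
    intro k hk
    obtain ⟨x, hx, rfl⟩ := Finset.mem_image.1 hk
    exact (Finset.mem_filter.1 hx).2
  have h3 : (J.card : ℝ) * (L / 2) ≤
      ∑ k ∈ J, (A.levelError k + 2 * A.levelError (k + L)) := by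
    rw [← nsmul_eq_mul]
    exact Finset.card_nsmul_le_sum _ _ _ fun k hk =>
      hLb k (Finset.mem_filter.1 hk).1 (Finset.mem_filter.1 hk).2
  rw [Finset.sum_add_distrib, ← Finset.mul_sum] at h3
  have h4 := mul_le_mul_of_nonneg_right hJcard (Nat.cast_nonneg L : (0 : ℝ) ≤ L)
  linarith

end QuantumAlgorithm

end BooleanMean

end

/-! ### The lower bound -/

theorem corollary5p1 (c α : ℝ) (hc : 0 < c) (hα : 0 < α) :
    ∃ C : ℝ, 0 < C ∧
      ∀ (q : ℝ), 1 ≤ q →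
      ∀ (I : ℕ → Finset ℕ) (Δ : ℕ → ℝ),
        (∀ n, I n ⊆ Finset.range (n + 1)) →
        (∀ n, ∃ a b : ℕ, I n = Finset.Icc a b) →
        Tendsto (fun n => (I n).card) atTop atTop →
        (∀ᶠ n : ℕ in atTop, ∀ k ∈ I n, α * (n : ℝ) ^ 2 ≤ (k : ℝ) * ((n : ℝ) - (k : ℝ))) →
        (∀ n, 0 < Δ n) →
        Δ =o[atTop] (fun n => ((I n).card : ℝ)) →
        ∀ᶠ n : ℕ in atTop,
          ∀ μ : BooleanMean.Input n → ℝ,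
            μ ∈ stdSimplex ℝ (BooleanMean.Input n) →
            (∀ X : BooleanMean.Input n, BooleanMean.weight X ∈ I n →
              c * ((I n).card : ℝ)⁻¹ * (1 / (n.choose (BooleanMean.weight X) : ℝ)) ≤ μ X) →
            ∀ (T : ℕ) (A : BooleanMean.QuantumAlgorithm n T),
              A.avgExpectedCountError q μ ≤ Δ n →
              C * min ((n : ℝ) / Δ n) (n : ℝ) ≤ (T : ℝ) := by
  -- `16` is the factor in `16TL ≤ αn`, and `13 / c + 1` bounds `L / max(Δ, 1)`.
  refine ⟨α / (16 * (13 / c + 1)), by positivity, ?_⟩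
  intro q hq I Δ hI hIcc hcard hbulk hΔ hΔo
  -- With `52 = 4 · 13` and `|I| ≥ 4`, both `13Δ/c` and the rounding error of the ceiling are at
  -- most `|I|/4`, so `2L ≤ |I|`.
  filter_upwards [hbulk, hcard.eventually_ge_atTop 4, eventually_gt_atTop 0,
    hΔo.bound (show (0 : ℝ) < c / 52 by positivity)] with n hbulk hm hn hΔm μ hμ hμI T A hA
  obtain ⟨a, b, hab⟩ := hIcc n
  have hn' : (0 : ℝ) < n := by exact_mod_cast hn
  have hΔn := hΔ n
  set L : ℕ := ⌈13 / c * Δ n⌉₊ with hLdef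
  have hL1 : 13 / c * Δ n ≤ L := Nat.le_ceil _
  have hL2 : (L : ℝ) < 13 / c * Δ n + 1 := Nat.ceil_lt_add_one (by positivity)
  have hmR : (4 : ℝ) ≤ (I n).card := by exact_mod_cast hm
  rw [Real.norm_of_nonneg hΔn.le, Real.norm_of_nonneg (by positivity)] at hΔm
  have hLm : 2 * L ≤ (I n).card := by
    have h1 : 13 / c * Δ n ≤ 13 / c * (c / 52 * (I n).card) := by gcongr
    have h2 : 13 / c * (c / 52 * ((I n).card : ℝ)) = (I n).card / 4 := by field_simp; norm_num
    have : (2 * L : ℝ) ≤ (I n).card := by linarith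
    exact_mod_cast this
  by_contra! hlt
  have hkn : ∀ k ∈ I n, k ≤ n := fun k hk => Nat.lt_succ_iff.1 (Finset.mem_range.1 (hI n hk))
  have hTL : 16 * ((T : ℝ) * L) ≤ α * n := by
    have hLmax : (L : ℝ) ≤ (13 / c + 1) * max (Δ n) 1 := by
      have h1 := mul_le_mul_of_nonneg_left (le_max_left (Δ n) 1) (by positivity : 0 ≤ 13 / c)
      have h2 := le_max_right (Δ n) 1
      linarith
    have hmm : min ((n : ℝ) / Δ n) n * max (Δ n) 1 ≤ n := by
      rcases le_total (Δ n) 1 with h | h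
      · rw [max_eq_right h, mul_one]; exact min_le_right _ _
      · rw [max_eq_left h]
        calc _ ≤ (n : ℝ) / Δ n * Δ n := by gcongr; exact min_le_left _ _
          _ = n := by field_simp
    calc 16 * ((T : ℝ) * L)
        ≤ 16 * (α / (16 * (13 / c + 1)) * min ((n : ℝ) / Δ n) n *
            ((13 / c + 1) * max (Δ n) 1)) := by gcongr
      _ = α * (min ((n : ℝ) / Δ n) n * max (Δ n) 1) := by field_simp
      _ ≤ α * n := by gcongr
  have hlevels : ∀ k ∈ I n, α * n ≤ k ∧ α * n ≤ ((n - k : ℕ) : ℝ) := by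
    intro k hk
    have h1 := hbulk k hk
    have h2 : (k : ℝ) ≤ n := by exact_mod_cast hkn k hk
    have h3 : (0 : ℝ) ≤ k := Nat.cast_nonneg k
    rw [Nat.cast_sub (hkn k hk)]
    -- Each factor of `k(n - k) ≥ αn²` is at most `n`, so the other is at least `αn`.
    constructor <;> refine le_of_mul_le_mul_right ?_ hn' <;> nlinarith
  have h1 := A.sum_levelError_le hn hq hμ.1 hμI
  rw [hab] at hkn hlevels hLm hmR h1
  have h2 := A.interval_card_mul_le hkn (by positivity) hlevels hLm hTL
  have hm0 : (0 : ℝ) < (Finset.Icc a b).card := by linarith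
  have h3 : c * ∑ k ∈ Finset.Icc a b, A.levelError k ≤ Δ n * (Finset.Icc a b).card := by
    have := mul_le_mul_of_nonneg_right (h1.trans hA) hm0.le
    calc _ = c * ((Finset.Icc a b).card : ℝ)⁻¹ * (∑ k ∈ Finset.Icc a b, A.levelError k) *
          (Finset.Icc a b).card := by field_simp
      _ ≤ _ := this
  have h4 : 13 * Δ n ≤ c * L := by
    have := mul_le_mul_of_nonneg_left hL1 hc.le
    calc 13 * Δ n = c * (13 / c * Δ n) := by field_simp
      _ ≤ _ := this
  have h5 := mul_le_mul_of_nonneg_left h2 hc.le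
  have h6 := mul_le_mul_of_nonneg_right h4 hm0.le
  have h7 := mul_pos hΔn hm0
  -- The chain `13Δ|I| ≤ cL|I| ≤ 12Δ|I|` is absurd since `Δ|I| > 0`.
  nlinarith
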